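/- Let $p\in(0,1]$ and $d\in\mathbb N$, and let $\mathbb N^d\subset\mathbb Z^d$ be endowed with the metric of $\ell_q^d$ for some $1\le q\le\infty$ (for instance the maximum metric, $q=\infty$, or the Euclidean metric, $q=2$). Then the Lipschitz free $p$-spaces $\mathcal F_p(\mathbb N^d)$ and $\mathcal F_p(\mathbb Z^d)$ are isomorphic, that is, there are bounded linear maps $S\colon\mathcal F_p(\mathbb N^d)\to\mathcal F_p(\mathbb Z^d)$ and $T\colon\mathcal F_p(\mathbb Z^d)\to\mathcal F_p(\mathbb N^d)$ with $T\circ S=\mathrm{Id}$ and $S\circ T=\mathrm{Id}$. Here, for a metric space $(M,\rho)$, $\mathcal F_p(M)$ is the completion of the real vector space of finitely supported functions $m\colon M\to\mathbb R$ with $\sum_{x}m(x)=0$ under the $p$-norm $$\|m\|=\inf\Big\{\Big(\sum_{j=1}^n |a_j|^p\rho(x_j,y_j)^p\Big)^{1/p} : m=\sum_{j=1}^n a_j(\delta(x_j)-\delta(y_j)),\ n\ge0,\ a_j\in\mathbb R,\ x_j,y_j\in M\Big\},$$ where $\delta(x)$ is the indicator function of $\{x\}$. Equivalently, for any base point $o\in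 M$, it is the $p$-Banach space, unique up to linear isometry, that contains $M$ isometrically via $x\mapsto\delta(x)-\delta(o)$ and such that every $K$-Lipschitz map from $M$ to a $p$-Banach space that vanishes at $o$ extends uniquely to a bounded linear map, of norm at most $K$. -/

import Mathlib

open scoped ENNReal

/-! ### `p`-Banach spaces and their isomorphisms -/

/-- `N` is a `p`-norm on the real vector space `X`. -/
structure IsPNorm (p : ℝ) {X : Type*} [AddCommGroup X] [Module ℝ X] (N : X → ℝ) : Prop where
  nonneg : ∀ x, 0 ≤ N x
  eq_zero : ∀ x, N x = 0 → x = 0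
  smul : ∀ (a : ℝ) (x : X), N (a • x) = |a| * N x
  add_rpow_le : ∀ x y, N (x + y) ^ p ≤ N x ^ p + N y ^ p

/-- `X` with the `p`-norm `N` is a `p`-Banach space: every `N`-Cauchy sequence converges. -/
structure IsPBanach (p : ℝ) {X : Type*} [AddCommGroup X] [Module ℝ X] (N : X → ℝ) : Prop
    extends IsPNorm p N where
  complete : ∀ u : ℕ → X,
    (∀ ε > 0, ∃ n₀ : ℕ, ∀ m ≥ n₀, ∀ n ≥ n₀, N (u m - u n) < ε) →
      ∃ x, ∀ ε > 0, ∃ n₀ : ℕ, ∀ n ≥ n₀, N (u n - x) < ε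

/-- A linear map is bounded with respect to the quasi-norms `NX` and `NY`. -/
def IsBoundedFor {X Y : Type*} [AddCommGroup X] [Module ℝ X] [AddCommGroup Y] [Module ℝ Y]
    (NX : X → ℝ) (NY : Y → ℝ) (S : X →ₗ[ℝ] Y) : Prop :=
  ∃ C : ℝ, ∀ x, NY (S x) ≤ C * NX x

/-- The quasi-normed spaces `(X, NX)` and `(Y, NY)` are isomorphic, `X ≃ Y`: there are
mutually inverse bounded linear maps between them. -/
def QuasiIsomorphic {X Y : Type*} [AddCommGroup X] [Module ℝ X] [AddCommGroup Y] [Module ℝ Y]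
    (NX : X → ℝ) (NY : Y → ℝ) : Prop :=
  ∃ (S : X →ₗ[ℝ] Y) (T : Y →ₗ[ℝ] X), IsBoundedFor NX NY S ∧ IsBoundedFor NY NX T ∧
    T ∘ₗ S = LinearMap.id ∧ S ∘ₗ T = LinearMap.id

/-! ### Molecules -/

/-- Molecules on `M`: finitely supported real functions on `M` whose values sum to `0`.
The parameter `p` only selects the (quasi-)norm put on this space below. -/
def Molecule (_p : ℝ) (M : Type*) : Type _ :=
  LinearMap.ker (Finsupp.linearCombination ℝ (fun _ : M => (1 : ℝ)))

namespace Molecule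

variable {p : ℝ} {M : Type*}

noncomputable instance : AddCommGroup (Molecule p M) :=
  inferInstanceAs (AddCommGroup
    (LinearMap.ker (Finsupp.linearCombination ℝ (fun _ : M => (1 : ℝ)))))

noncomputable instance : Module ℝ (Molecule p M) :=
  inferInstanceAs (Module ℝ
    (LinearMap.ker (Finsupp.linearCombination ℝ (fun _ : M => (1 : ℝ)))))

/-- The molecule as a finitely supported function. -/
noncomputable def toFinsupp (p : ℝ) (M : Type*) : Molecule p M →ₗ[ℝ] (M →₀ ℝ) :=
  (LinearMap.ker (Finsupp.linearCombination ℝ (fun _ : M => (1 : ℝ)))).subtype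

theorem toFinsupp_injective : Function.Injective (toFinsupp p M) := Subtype.val_injective

/-- The elementary molecule `δ(x) - δ(y)`. -/
noncomputable def elem (p : ℝ) {M : Type*} (x y : M) : Molecule p M :=
  ⟨Finsupp.single x 1 - Finsupp.single y 1, by simp⟩

@[simp] theorem toFinsupp_elem (x y : M) :
    toFinsupp p M (elem p x y) = Finsupp.single x 1 - Finsupp.single y 1 := rfl

/-- The molecule `∑ⱼ aⱼ (δ(xⱼ) - δ(yⱼ))` coded by a finite list of triples `(aⱼ, xⱼ, yⱼ)`. -/
noncomputable def ofList (p : ℝ) {M : Type*} (l : List (ℝ × M × M)) : Molecule p M :=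
  (l.map fun t => t.1 • elem p t.2.1 t.2.2).sum

@[simp] theorem ofList_nil : ofList p ([] : List (ℝ × M × M)) = 0 := rfl

@[simp] theorem ofList_cons (t : ℝ × M × M) (l : List (ℝ × M × M)) :
    ofList p (t :: l) = t.1 • elem p t.2.1 t.2.2 + ofList p l := by
  simp [ofList]

@[simp] theorem ofList_append (l l' : List (ℝ × M × M)) :
    ofList p (l ++ l') = ofList p l + ofList p l' := by
  simp [ofList]

theorem ofList_smul (c : ℝ) (l : List (ℝ × M × M)) :
    ofList p (l.map fun t => (c * t.1, t.2)) = c • ofList p l := by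
  induction l with
  | nil => simp
  | cons t l ih => simp [ih, mul_smul]

theorem exists_ofList (m : Molecule p M) : ∃ l, ofList p l = m := by
  classical
  rcases isEmpty_or_nonempty M with h | ⟨⟨o⟩⟩
  · exact ⟨[], toFinsupp_injective (Subsingleton.elim _ _)⟩
  · refine ⟨(toFinsupp p M m).support.toList.map fun x => (toFinsupp p M m x, x, o), ?_⟩
    apply toFinsupp_injective
    have hm : Finsupp.linearCombination ℝ (fun _ : M => (1 : ℝ)) (toFinsupp p M m) = 0 := m.2
    rw [Finsupp.linearCombination_apply, Finsupp.sum] at hm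
    rw [ofList, List.map_map, Finset.sum_map_toList, map_sum]
    simp only [Function.comp_def, map_smul, toFinsupp_elem, smul_sub, Finset.sum_sub_distrib]
    rw [← Finset.sum_smul]
    have : ∑ i ∈ (toFinsupp p M m).support, toFinsupp p M m i = 0 := by simpa using hm
    rw [this, zero_smul, sub_zero]
    conv_rhs => rw [← Finsupp.sum_single (toFinsupp p M m)]
    simp [Finsupp.sum]

variable [MetricSpace M]

/-- `∑ⱼ (|aⱼ| d(xⱼ, yⱼ))ᵖ`. -/
noncomputable def cost (p : ℝ) {M : Type*} [MetricSpace M] (l : List (ℝ × M × M)) : ℝ :=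
  (l.map fun t => (|t.1| * dist t.2.1 t.2.2) ^ p).sum

@[simp] theorem cost_nil : cost p ([] : List (ℝ × M × M)) = 0 := rfl

@[simp] theorem cost_cons (t : ℝ × M × M) (l : List (ℝ × M × M)) :
    cost p (t :: l) = (|t.1| * dist t.2.1 t.2.2) ^ p + cost p l := by
  simp [cost]

@[simp] theorem cost_append (l l' : List (ℝ × M × M)) :
    cost p (l ++ l') = cost p l + cost p l' := by
  simp [cost]

theorem cost_nonneg (l : List (ℝ × M × M)) : 0 ≤ cost p l := by
  refine List.sum_nonneg fun a ha => ?_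
  obtain ⟨t, -, rfl⟩ := List.mem_map.1 ha
  positivity

theorem cost_smul (c : ℝ) (l : List (ℝ × M × M)) :
    cost p (l.map fun t => (c * t.1, t.2)) = |c| ^ p * cost p l := by
  induction l with
  | nil => simp
  | cons t l ih =>
    rw [List.map_cons, cost_cons, cost_cons, ih, abs_mul, mul_assoc,
      Real.mul_rpow (abs_nonneg _) (by positivity)]
    ring

/-- The `p`-th power of the free `p`-norm of a molecule: the infimum of
`∑ⱼ (|aⱼ| d(xⱼ, yⱼ))ᵖ` over all finite representations `m = ∑ⱼ aⱼ (δ(xⱼ) - δ(yⱼ))`. -/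
noncomputable def normPow (m : Molecule p M) : ℝ :=
  sInf (cost p '' {l | ofList p l = m})

theorem normPow_nonneg (m : Molecule p M) : 0 ≤ normPow m :=
  Real.sInf_nonneg (by rintro _ ⟨l, -, rfl⟩; exact cost_nonneg l)

theorem normPow_le (l : List (ℝ × M × M)) : normPow (ofList p l) ≤ cost p l :=
  csInf_le ⟨0, by rintro _ ⟨l, -, rfl⟩; exact cost_nonneg l⟩ ⟨l, rfl, rfl⟩

theorem le_normPow {m : Molecule p M} {c : ℝ} (h : ∀ l, ofList p l = m → c ≤ cost p l) :
    c ≤ normPow m := by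
  obtain ⟨l, hl⟩ := exists_ofList m
  exact le_csInf ⟨_, l, hl, rfl⟩ (by rintro _ ⟨l, hl, rfl⟩; exact h l hl)

theorem normPow_smul_le (c : ℝ) (m : Molecule p M) : normPow (c • m) ≤ |c| ^ p * normPow m := by
  have h : ∀ l, ofList p l = m → normPow (c • m) ≤ |c| ^ p * cost p l := by
    rintro l rfl
    rw [← ofList_smul, ← cost_smul]
    exact normPow_le _
  rcases (Real.rpow_nonneg (abs_nonneg c) p).eq_or_lt with h0 | h0
  · obtain ⟨l, hl⟩ := exists_ofList m
    simpa [← h0] using h l hl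
  · rw [← div_le_iff₀' h0]
    exact le_normPow fun l hl => (div_le_iff₀' h0).2 (h l hl)

theorem normPow_add_le (m m' : Molecule p M) : normPow (m + m') ≤ normPow m + normPow m' := by
  rw [← sub_le_iff_le_add]
  refine le_normPow fun l hl => ?_
  rw [sub_le_iff_le_add, ← sub_le_iff_le_add']
  refine le_normPow fun l' hl' => ?_
  rw [sub_le_iff_le_add', ← hl, ← hl', ← ofList_append, ← cost_append]
  exact normPow_le _

/-- The translation invariant pseudometric `‖m - m'‖ᵖ` on molecules.  The `Norm` of Mathlib is
thus the `p`-th power of the free `p`-norm. -/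
noncomputable instance : SeminormedAddCommGroup (Molecule p M) :=
  AddGroupSeminorm.toSeminormedAddCommGroup
    { toFun := normPow
      map_zero' := le_antisymm (normPow_le (p := p) (M := M) []) (normPow_nonneg _)
      add_le' := normPow_add_le
      neg' := by
        have h : ∀ m : Molecule p M, normPow (-m) ≤ normPow m := fun m => by
          simpa using normPow_smul_le (-1) m
        exact fun m => le_antisymm (h m) (by simpa using h (-m)) }

theorem norm_def (m : Molecule p M) : ‖m‖ = normPow m := rfl

instance : UniformContinuousConstSMul ℝ (Molecule p M) where
  uniformContinuous_const_smul c := by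
    have : LipschitzWith (Real.toNNReal (|c| ^ p)) (fun m : Molecule p M => c • m) := by
      refine LipschitzWith.of_dist_le_mul fun m m' => ?_
      rw [dist_eq_norm, dist_eq_norm, ← smul_sub,
        Real.coe_toNNReal _ (Real.rpow_nonneg (abs_nonneg c) p)]
      exact normPow_smul_le _ _
    exact this.uniformContinuous

theorem norm_smul_eq (hp : 0 < p) (c : ℝ) (m : Molecule p M) : ‖c • m‖ = |c| ^ p * ‖m‖ := by
  rcases eq_or_ne c 0 with rfl | hc
  · simp [Real.zero_rpow hp.ne']
  · refine le_antisymm (normPow_smul_le _ _) ?_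
    have h := normPow_smul_le c⁻¹ (c • m)
    rw [smul_smul, inv_mul_cancel₀ hc, one_smul, abs_inv, Real.inv_rpow (abs_nonneg c),
      ← div_eq_inv_mul, le_div_iff₀' (Real.rpow_pos_of_pos (abs_pos.2 hc) p)] at h
    exact h

end Molecule

/-! ### The Lipschitz free `p`-space -/

/-- The Lipschitz free `p`-space over the metric space `M`: the completion of the space of
molecules on `M` for the free `p`-norm. -/
abbrev LipschitzFree (p : ℝ) (M : Type*) [MetricSpace M] : Type _ :=
  UniformSpace.Completion (Molecule p M)

namespace LipschitzFree

variable {p : ℝ} {M : Type*} [MetricSpace M]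

/-- The `p`-norm of the Lipschitz free `p`-space. -/
noncomputable def pnorm (x : LipschitzFree p M) : ℝ := ‖x‖ ^ (1 / p)

/-- The canonical map of `M`, pointed at `o`, into its Lipschitz free `p`-space; in terms of
molecules, `x` goes to `δ(x) - δ(o)`. -/
noncomputable def delta (p : ℝ) {M : Type*} [MetricSpace M] (o x : M) : LipschitzFree p M :=
  ((Molecule.elem p x o : Molecule p M) : LipschitzFree p M)

theorem pnorm_rpow (hp : 0 < p) (x : LipschitzFree p M) : pnorm x ^ p = ‖x‖ := by
  rw [pnorm, ← Real.rpow_mul (norm_nonneg x), one_div_mul_cancel hp.ne', Real.rpow_one]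

theorem norm_smul_eq (hp : 0 < p) (c : ℝ) (x : LipschitzFree p M) :
    ‖c • x‖ = |c| ^ p * ‖x‖ := by
  induction x using UniformSpace.Completion.induction_on with
  | hp => exact isClosed_eq (continuous_norm.comp (continuous_const_smul c)) (by fun_prop)
  | ih m =>
    rw [← UniformSpace.Completion.coe_smul, UniformSpace.Completion.norm_coe,
      UniformSpace.Completion.norm_coe, Molecule.norm_smul_eq hp]

/-- The Lipschitz free `p`-space is a `p`-Banach space. -/
theorem isPBanach (hp : 0 < p) : IsPBanach p (pnorm : LipschitzFree p M → ℝ) where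
  nonneg x := Real.rpow_nonneg (norm_nonneg x) _
  eq_zero x hx := by
    rw [← norm_eq_zero, ← pnorm_rpow hp, hx, Real.zero_rpow hp.ne']
  smul c x := by
    rw [pnorm, norm_smul_eq hp, Real.mul_rpow (by positivity) (norm_nonneg x),
      ← Real.rpow_mul (abs_nonneg c), mul_one_div_cancel hp.ne', Real.rpow_one, pnorm]
  add_rpow_le x y := by
    simpa only [pnorm_rpow hp] using norm_add_le x y
  complete u hu := by
    have key : ∀ (x : LipschitzFree p M) (ε : ℝ), 0 < ε → (‖x‖ < ε ^ p ↔ pnorm x < ε) := by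
      intro x ε hε
      rw [← pnorm_rpow hp]
      exact Real.rpow_lt_rpow_iff (Real.rpow_nonneg (norm_nonneg x) _) hε.le hp
    have hc : CauchySeq u := by
      rw [Metric.cauchySeq_iff]
      intro ε hε
      obtain ⟨n₀, h⟩ := hu (ε ^ (1 / p)) (by positivity)
      refine ⟨n₀, fun m hm n hn => ?_⟩
      have := (key _ _ (by positivity)).2 (h m hm n hn)
      rwa [← Real.rpow_mul hε.le, one_div_mul_cancel hp.ne', Real.rpow_one,
        ← dist_eq_norm] at this
    obtain ⟨x, hx⟩ := cauchySeq_tendsto_of_complete hc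
    refine ⟨x, fun ε hε => ?_⟩
    obtain ⟨n₀, h⟩ := Metric.tendsto_atTop.1 hx (ε ^ p) (by positivity)
    refine ⟨n₀, fun n hn => (key _ _ hε).1 ?_⟩
    rw [← dist_eq_norm]
    exact h n hn

section Universal

variable {Y : Type*} [AddCommGroup Y] [Module ℝ Y] {N : Y → ℝ}

/-- The linear extension of `f` to molecules. -/
noncomputable def lift₀ (p : ℝ) (f : M → Y) : Molecule p M →ₗ[ℝ] Y :=
  Finsupp.linearCombination ℝ f ∘ₗ Molecule.toFinsupp p M

@[simp] theorem lift₀_elem {M : Type*} (f : M → Y) (x y : M) :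
    lift₀ p f (Molecule.elem p x y) = f x - f y := by
  simp [lift₀]

theorem lift₀_bound (hp : 0 < p) (hN : IsPNorm p N) {f : M → Y} {K : ℝ} (hK : 0 ≤ K)
    (hf : ∀ x y, N (f x - f y) ≤ K * dist x y) (m : Molecule p M) :
    N (lift₀ p f m) ^ p ≤ K ^ p * ‖m‖ := by
  have hl : ∀ l, N (lift₀ p f (Molecule.ofList p l)) ^ p ≤ K ^ p * Molecule.cost p l := by
    intro l
    induction l with
    | nil =>
      have : N 0 = 0 := by simpa using hN.smul 0 0
      simp [this, Real.zero_rpow hp.ne']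
    | cons t l ih =>
      rw [Molecule.ofList_cons, map_add, map_smul, lift₀_elem, Molecule.cost_cons, mul_add]
      refine (hN.add_rpow_le _ _).trans (add_le_add ?_ ih)
      rw [hN.smul, ← Real.mul_rpow hK (by positivity)]
      refine Real.rpow_le_rpow (mul_nonneg (abs_nonneg _) (hN.nonneg _)) ?_ hp.le
      calc |t.1| * N (f t.2.1 - f t.2.2) ≤ |t.1| * (K * dist t.2.1 t.2.2) :=
            mul_le_mul_of_nonneg_left (hf _ _) (abs_nonneg _)
        _ = _ := by ring
  rcases (Real.rpow_nonneg hK p).eq_or_lt with h0 | h0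
  · obtain ⟨l, rfl⟩ := Molecule.exists_ofList m
    simpa [← h0] using hl l
  · rw [← div_le_iff₀' h0]
    refine Molecule.le_normPow ?_
    rintro l rfl
    exact (div_le_iff₀' h0).2 (hl l)

/-- The canonical map is an isometric embedding. -/
theorem pnorm_delta_sub (hp : 0 < p) (hp1 : p ≤ 1) (o x y : M) :
    pnorm (delta p o x - delta p o y) = dist x y := by
  have hxy : delta p o x - delta p o y =
      ((Molecule.elem p x y : Molecule p M) : LipschitzFree p M) := by
    rw [delta, delta, ← UniformSpace.Completion.coe_sub]
    congr 1
    exact Molecule.toFinsupp_injective (by simp)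
  have hR : IsPNorm p (fun t : ℝ => |t|) :=
    ⟨abs_nonneg, fun t => abs_eq_zero.1, fun a t => by simp [abs_mul], fun s t =>
      (Real.rpow_le_rpow (abs_nonneg _) (abs_add_le s t) hp.le).trans
        (Real.rpow_add_le_add_rpow (abs_nonneg _) (abs_nonneg _) hp.le hp1)⟩
  have h1 : dist x y ^ p ≤ ‖Molecule.elem p x y‖ := by
    have := lift₀_bound hp hR (f := fun z : M => dist z y) (K := 1) zero_le_one
      (fun a b => by simpa [one_mul] using abs_dist_sub_le a b y) (Molecule.elem p x y)
    simpa using this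
  have h2 : ‖Molecule.elem p x y‖ ≤ dist x y ^ p := by
    have := Molecule.normPow_le (p := p) [((1 : ℝ), x, y)]
    simpa [Molecule.norm_def] using this
  rw [hxy, pnorm, UniformSpace.Completion.norm_coe, le_antisymm h2 h1,
    ← Real.rpow_mul dist_nonneg, mul_one_div_cancel hp.ne', Real.rpow_one]

/-- The universal property: every `K`-Lipschitz map `f`, vanishing at the base point, into a
`p`-Banach space extends uniquely to a bounded linear map, and the extension has norm at most
`K`. -/
theorem universal (hp : 0 < p) (hN : IsPBanach p N) (o : M) {f : M → Y} (hfo : f o = 0)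
    {K : ℝ} (hK : 0 ≤ K) (hf : ∀ x y, N (f x - f y) ≤ K * dist x y) :
    ∃ L : LipschitzFree p M →ₗ[ℝ] Y, (∀ x, L (delta p o x) = f x) ∧
      (∀ z, N (L z) ≤ K * pnorm z) ∧
      ∀ L' : LipschitzFree p M →ₗ[ℝ] Y, IsBoundedFor pnorm N L' →
        (∀ x, L' (delta p o x) = f x) → L' = L := by
  have hN0 : N 0 = 0 := by simpa using hN.smul 0 0
  let : NormedAddCommGroup Y := AddGroupNorm.toNormedAddCommGroup
    { toFun := fun y => N y ^ p
      map_zero' := by simp [hN0, Real.zero_rpow hp.ne']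
      add_le' := hN.add_rpow_le
      neg' := fun y => by
        have := hN.smul (-1) y
        simp only [neg_smul, one_smul, abs_neg, abs_one, one_mul] at this
        simp [this]
      eq_zero_of_map_eq_zero' := fun y hy =>
        hN.eq_zero y ((Real.rpow_eq_zero (hN.nonneg y) hp.ne').1 hy) }
  have hnorm : ∀ y : Y, ‖y‖ = N y ^ p := fun _ => rfl
  have key : ∀ (y : Y) (ε : ℝ), 0 < ε → (‖y‖ < ε ^ p ↔ N y < ε) := fun y ε hε => by
    rw [hnorm]
    exact Real.rpow_lt_rpow_iff (hN.nonneg y) hε.le hp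
  have : CompleteSpace Y := by
    refine Metric.complete_of_cauchySeq_tendsto fun u hu => ?_
    obtain ⟨y, hy⟩ := hN.complete u fun ε hε => by
      obtain ⟨n₀, h⟩ := Metric.cauchySeq_iff.1 hu (ε ^ p) (by positivity)
      refine ⟨n₀, fun m hm n hn => (key _ _ hε).1 ?_⟩
      rw [← dist_eq_norm]
      exact h m hm n hn
    refine ⟨y, Metric.tendsto_atTop.2 fun ε hε => ?_⟩
    obtain ⟨n₀, h⟩ := hy (ε ^ (1 / p)) (by positivity)
    refine ⟨n₀, fun n hn => ?_⟩
    have := (key _ _ (by positivity)).2 (h n hn)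
    rwa [← Real.rpow_mul hε.le, one_div_mul_cancel hp.ne', Real.rpow_one,
      ← dist_eq_norm] at this
  have hlip : ∀ (C : ℝ) (F : LipschitzFree p M →ₗ[ℝ] Y), 0 ≤ C →
      (∀ z, ‖F z‖ ≤ C * ‖z‖) → Continuous F := fun C F hC h =>
    (LipschitzWith.of_dist_le_mul (K := ⟨C, hC⟩) fun a b => by
      rw [dist_eq_norm, dist_eq_norm, ← map_sub]; exact h _).continuous
  have hKp : 0 ≤ K ^ p := Real.rpow_nonneg hK p
  have hbd : ∀ m, ‖lift₀ p f m‖ ≤ K ^ p * ‖m‖ := lift₀_bound hp hN.toIsPNorm hK hf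
  have hu : UniformContinuous (lift₀ p f) :=
    (LipschitzWith.of_dist_le_mul (K := ⟨K ^ p, hKp⟩) fun a b => by
      rw [dist_eq_norm, dist_eq_norm, ← map_sub]; exact hbd _).uniformContinuous
  have hsm : ∀ c : ℝ, Continuous fun y : Y => c • y := fun c =>
    (LipschitzWith.of_dist_le_mul (K := ⟨|c| ^ p, by positivity⟩) fun a b => by
      rw [dist_eq_norm, dist_eq_norm, ← smul_sub, hnorm, hN.smul,
        Real.mul_rpow (abs_nonneg c) (hN.nonneg _)]
      exact le_of_eq rfl).continuous
  have hE : Continuous (UniformSpace.Completion.extension (lift₀ p f)) :=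
    UniformSpace.Completion.continuous_extension
  have hEc : ∀ m : Molecule p M,
      UniformSpace.Completion.extension (lift₀ p f) (m : LipschitzFree p M) = lift₀ p f m :=
    UniformSpace.Completion.extension_coe hu
  let L : LipschitzFree p M →ₗ[ℝ] Y :=
    { toFun := UniformSpace.Completion.extension (lift₀ p f)
      map_add' := fun a b => by
        induction a, b using UniformSpace.Completion.induction_on₂ with
        | hp => exact isClosed_eq (by fun_prop) (by fun_prop)
        | ih a b => rw [← UniformSpace.Completion.coe_add, hEc, hEc, hEc, map_add]
      map_smul' := fun c a => by
        induction a using UniformSpace.Completion.induction_on with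
        | hp => exact isClosed_eq (hE.comp (continuous_const_smul c)) ((hsm c).comp hE)
        | ih a => rw [← UniformSpace.Completion.coe_smul, hEc, hEc, map_smul, RingHom.id_apply] }
  have hLc : ∀ m : Molecule p M, L (m : LipschitzFree p M) = lift₀ p f m := hEc
  have hLcont : Continuous L := hE
  refine ⟨L, fun x => ?_, fun z => ?_, fun L' ⟨C, hC⟩ hL' => ?_⟩
  · rw [delta, hLc, lift₀_elem, hfo, sub_zero]
  · have h : ‖L z‖ ≤ K ^ p * ‖z‖ := by
      induction z using UniformSpace.Completion.induction_on with
      | hp => exact isClosed_le (by fun_prop) (by fun_prop)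
      | ih m => rw [hLc, UniformSpace.Completion.norm_coe]; exact hbd m
    have hz : 0 ≤ pnorm z := (isPBanach hp).nonneg z
    rw [hnorm, ← pnorm_rpow hp, ← Real.mul_rpow hK hz] at h
    exact (Real.rpow_le_rpow_iff (hN.nonneg _) (mul_nonneg hK hz) hp).1 h
  · have hC' : ∀ z, ‖L' z‖ ≤ |C| ^ p * ‖z‖ := fun z => by
      have hz : 0 ≤ pnorm z := (isPBanach hp).nonneg z
      rw [hnorm, ← pnorm_rpow hp, ← Real.mul_rpow (abs_nonneg C) hz]
      exact Real.rpow_le_rpow (hN.nonneg _)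
        ((hC z).trans (mul_le_mul_of_nonneg_right (le_abs_self C) hz)) hp.le
    have hcont' : Continuous L' := hlip _ _ (by positivity) hC'
    have hel : ∀ x y : M, L' ((Molecule.elem p x y : Molecule p M) : LipschitzFree p M) =
        f x - f y := fun x y => by
      have : Molecule.elem p x y = Molecule.elem p x o - Molecule.elem p y o :=
        Molecule.toFinsupp_injective (by simp)
      rw [this, UniformSpace.Completion.coe_sub, map_sub, ← hL' x, ← hL' y]
      rfl
    refine LinearMap.ext fun z => ?_
    induction z using UniformSpace.Completion.induction_on with
    | hp => exact isClosed_eq hcont' hLcont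
    | ih m =>
      obtain ⟨l, rfl⟩ := Molecule.exists_ofList m
      rw [hLc]
      induction l with
      | nil => rw [Molecule.ofList_nil, UniformSpace.Completion.coe_zero, map_zero, map_zero]
      | cons t l ih =>
        rw [Molecule.ofList_cons, UniformSpace.Completion.coe_add,
          UniformSpace.Completion.coe_smul, map_add, map_smul, hel, ih, map_add, map_smul,
          lift₀_elem]

end Universal

end LipschitzFree

-- Let X be the space of molecules on ℤ^d, Y that on the positive lattice points, and ℓ(X) the
-- finitely supported sequences in X. Norms are p-th powers of p-norms, hence subadditive, so that
-- the sum of the norms on ℓ(X) is the p-th power of an ℓ_p-sum. Pełczyński's decomposition method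
-- (`nonempty_equiv_of_complemented`) makes F isomorphic to ℓ(X) as soon as each of the two is
-- complemented in the other. It is applied to F = Y and to F = X.
--
-- The positive points are a Lipschitz retract of ℤ^d, so Y is complemented in X, and X is a summand
-- of ℓ(X). What remains is that ℓ(X) is complemented in Y. A dyadic partition of unity cuts a
-- molecule into pieces on the cubes [-2^n, 2^n]^d. This map X → ℓ(X) is bounded, because a cutoff
-- at scale 2^n has slope of order 2^(-n) and each point meets at most two pieces; summation is a
-- left inverse (`sumL_spreadL`). Infinitely many copies of every such cube fit into the positive
-- orthant, separated well enough for Lipschitz cutoffs to recover the pieces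
-- (`retrieveL_placeL_pairL_spreadL`).
--
-- All this takes place before completion. Bounded maps and the identities between them extend by
-- density (`LipschitzFree.quasiIsomorphic_of_equiv`). The ℓ_q metrics on a finite product are
-- bi-Lipschitz equivalent, so the maximum metric suffices.

/-! ### `p`-homogeneous seminorms -/

/-- The seminorm of `E` is homogeneous of degree `p`, like the `p`-th power of a `p`-norm. -/
def IsPHomogeneous (p : ℝ) (E : Type*) [SeminormedAddCommGroup E] [Module ℝ E] : Prop :=
  ∀ (c : ℝ) (x : E), ‖c • x‖ = |c| ^ p * ‖x‖

section PHomogeneous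

variable {p : ℝ} {E F : Type*} [SeminormedAddCommGroup E] [Module ℝ E]
  [SeminormedAddCommGroup F] [Module ℝ F]

/-- Continuity at 0 rescales to a bound, since multiplication by `s ^ (1 / p)` multiplies both norms
by `s`. An explicit constant is needed to apply a map to all summands of an ℓ₁-sum at once. -/
theorem IsPHomogeneous.exists_bound (hp : 0 < p) (hE : IsPHomogeneous p E)
    (hF : IsPHomogeneous p F) (f : E →L[ℝ] F) : ∃ C, 0 ≤ C ∧ ∀ x, ‖f x‖ ≤ C * ‖x‖ := by
  obtain ⟨δ, hδ, h⟩ := Metric.continuous_iff.1 f.continuous 0 1 one_pos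
  simp only [dist_zero_right, map_zero] at h
  have key : ∀ (x : E) (s : ℝ), 0 < s → s * ‖x‖ < δ → s * ‖f x‖ < 1 := by
    intro x s hs hx
    have hc : |s ^ (1 / p)| ^ p = s := by
      rw [abs_of_nonneg (by positivity), ← Real.rpow_mul hs.le, one_div_mul_cancel hp.ne',
        Real.rpow_one]
    have := h (s ^ (1 / p) • x) (by rwa [hE, hc])
    rwa [map_smul, hF, hc] at this
  refine ⟨2 / δ, by positivity, fun x => ?_⟩
  rcases (norm_nonneg x).eq_or_lt with hx | hx
  -- A vector of seminorm 0 stays in the δ-ball under every rescaling, so its image must have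
  -- seminorm 0.
  · rw [← hx, mul_zero]
    by_contra! hf
    have := key x (1 / ‖f x‖) (by positivity) (by rw [← hx, mul_zero]; exact hδ)
    rw [one_div_mul_cancel hf.ne'] at this
    exact lt_irrefl _ this
  · have := key x (δ / 2 / ‖x‖) (by positivity) (by
      rw [div_mul_cancel₀ _ hx.ne']; linarith)
    rw [div_mul_eq_mul_div, div_lt_one hx] at this
    rw [div_mul_eq_mul_div, le_div_iff₀ hδ]
    linarith

end PHomogeneous

/-! ### Finitely supported `ℓ₁`-sums -/

namespace Finsupp

variable {p : ℝ} {ι κ E F : Type*} [SeminormedAddCommGroup E] [Module ℝ E]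
  [SeminormedAddCommGroup F] [Module ℝ F]

omit [Module ℝ E] in
theorem sum_norm_eq_of_support_subset (f : ι →₀ E) {s : Finset ι}
    (hs : ∀ i ∉ s, f i = 0) : (f.sum fun _ x => ‖x‖) = ∑ i ∈ s, ‖f i‖ :=
  Finsupp.sum_of_support_subset _ (fun i hi => by
    by_contra h
    exact (Finsupp.mem_support_iff.1 hi) (hs i h)) _ (by simp)

/-- The sum of the norms of the values. -/
noncomputable instance : SeminormedAddCommGroup (ι →₀ E) :=
  AddGroupSeminorm.toSeminormedAddCommGroup
    { toFun := fun f => f.sum fun _ x => ‖x‖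
      map_zero' := by simp
      add_le' := fun f g => by
        classical
        rw [sum_norm_eq_of_support_subset (f + g) (s := f.support ∪ g.support),
          sum_norm_eq_of_support_subset f (s := f.support ∪ g.support),
          sum_norm_eq_of_support_subset g (s := f.support ∪ g.support),
          ← Finset.sum_add_distrib]
        · exact Finset.sum_le_sum fun i _ => norm_add_le _ _
        all_goals
          intro i hi
          simp only [Finset.mem_union, Finsupp.mem_support_iff, not_or, not_not] at hi
          simp [hi]
      neg' := fun f => by
        rw [sum_norm_eq_of_support_subset (-f) (s := f.support)]
        · simp [Finsupp.sum]
        · intro i hi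
          simpa using hi }

omit [Module ℝ E] in
theorem norm_def (f : ι →₀ E) : ‖f‖ = f.sum fun _ x => ‖x‖ := rfl

omit [Module ℝ E] in
@[simp] theorem norm_single (i : ι) (x : E) : ‖single i x‖ = ‖x‖ := by
  simp [norm_def]

theorem isPHomogeneous (hE : IsPHomogeneous p E) :
    IsPHomogeneous p (ι →₀ E) := by
  intro c f
  rw [norm_def, norm_def, sum_norm_eq_of_support_subset (c • f) (s := f.support)]
  · simp only [Finsupp.smul_apply, hE c, Finsupp.sum, Finset.mul_sum]
  · intro i hi
    simp [Finsupp.notMem_support_iff.1 hi]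

/-- The bounded linear map on the `ℓ₁`-sum given by a uniformly bounded family. -/
noncomputable def lsumL (f : ι → E →ₗ[ℝ] F) (h : ∃ C, ∀ i x, ‖f i x‖ ≤ C * ‖x‖) :
    (ι →₀ E) →L[ℝ] F where
  toLinearMap := Finsupp.lsum ℝ f
  cont := by
    obtain ⟨C, hC⟩ := h
    refine AddMonoidHomClass.continuous_of_bound (Finsupp.lsum ℝ f) C fun x => ?_
    rw [Finsupp.lsum_apply, norm_def, Finsupp.sum, Finsupp.sum, Finset.mul_sum]
    exact (norm_sum_le _ _).trans (Finset.sum_le_sum fun i _ => hC i _)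

@[simp] theorem lsumL_single (f : ι → E →ₗ[ℝ] F) (h) (i : ι) (x : E) :
    lsumL f h (single i x) = f i x := by
  simp [lsumL]

theorem norm_lsumL_le {f : ι → E →ₗ[ℝ] F} {C : ℝ} (h) (hC : ∀ i x, ‖f i x‖ ≤ C * ‖x‖)
    (x : ι →₀ E) : ‖lsumL f h x‖ ≤ C * ‖x‖ := by
  change ‖Finsupp.lsum ℝ f x‖ ≤ _
  rw [Finsupp.lsum_apply, norm_def, Finsupp.sum, Finsupp.sum, Finset.mul_sum]
  exact (norm_sum_le _ _).trans (Finset.sum_le_sum fun i _ => hC i _)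

theorem clm_ext {f g : (ι →₀ E) →L[ℝ] F} (h : ∀ i x, f (single i x) = g (single i x)) :
    f = g :=
  ContinuousLinearMap.coe_injective (Finsupp.lhom_ext h)

/-- The inclusion of a summand. -/
noncomputable def singleL (i : ι) : E →L[ℝ] (ι →₀ E) where
  toLinearMap := Finsupp.lsingle i
  cont := AddMonoidHomClass.continuous_of_bound (Finsupp.lsingle (R := ℝ) i : E →ₗ[ℝ] (ι →₀ E)) 1
    fun x => by simp

@[simp] theorem singleL_apply (i : ι) (x : E) : singleL i x = single i x := rfl

/-- The projection onto a summand. -/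
noncomputable def evalL [DecidableEq ι] (i : ι) : (ι →₀ E) →L[ℝ] E :=
  lsumL (fun j => if j = i then LinearMap.id else 0) ⟨1, fun j x => by
    by_cases h : j = i <;> simp [h]⟩

@[simp] theorem evalL_single [DecidableEq ι] (i j : ι) (x : E) :
    evalL i (single j x) = if j = i then x else 0 := by
  by_cases h : j = i <;> simp [evalL, h]

/-- A bounded linear map applied to each summand. -/
noncomputable def mapL (hp : 0 < p) (hE : IsPHomogeneous p E) (hF : IsPHomogeneous p F)
    (f : E →L[ℝ] F) : (ι →₀ E) →L[ℝ] (ι →₀ F) :=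
  lsumL (fun i => Finsupp.lsingle i ∘ₗ f.toLinearMap) (by
    obtain ⟨C, -, hC⟩ := hE.exists_bound hp hF f
    exact ⟨C, fun i x => by simpa using hC x⟩)

@[simp] theorem mapL_single (hp : 0 < p) (hE : IsPHomogeneous p E) (hF : IsPHomogeneous p F)
    (f : E →L[ℝ] F) (i : ι) (x : E) :
    mapL hp hE hF f (single i x) = single i (f x) := by
  simp [mapL]

/-- Reindexing of the summands. -/
noncomputable def reindexL (e : ι → κ) : (ι →₀ E) →L[ℝ] (κ →₀ E) :=
  lsumL (fun i => Finsupp.lsingle (e i)) ⟨1, fun i x => by simp⟩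

@[simp] theorem reindexL_single (e : ι → κ) (i : ι) (x : E) :
    reindexL e (single i x) = single (e i) x := by
  simp [reindexL]

theorem norm_reindexL_le (e : ι → κ) (f : ι →₀ E) : ‖reindexL e f‖ ≤ 1 * ‖f‖ :=
  norm_lsumL_le _ (fun i x => by simp) f

/-- Removal of the first summand. -/
noncomputable def tailL : (ℕ →₀ E) →L[ℝ] (ℕ →₀ E) :=
  lsumL (fun i => if i = 0 then 0 else Finsupp.lsingle (i - 1)) ⟨1, fun i x => by
    by_cases h : i = 0 <;> simp [h]⟩

@[simp] theorem tailL_single_zero (x : E) : tailL (single 0 x) = 0 := by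
  simp [tailL]

@[simp] theorem tailL_single_succ (i : ℕ) (x : E) :
    tailL (single (i + 1) x) = single i x := by
  simp [tailL]

/-- An `ℓ₁`-sum of `ℓ₁`-sums is an `ℓ₁`-sum. -/
noncomputable def pairL : (ℕ →₀ ℕ →₀ E) ≃L[ℝ] (ℕ →₀ E) :=
  ContinuousLinearEquiv.equivOfInverse'
    (lsumL (fun k => (reindexL (Nat.pair k)).toLinearMap) ⟨1, fun k f => norm_reindexL_le _ f⟩)
    (lsumL (fun j => (Finsupp.lsingle (Nat.unpair j).1 ∘ₗ Finsupp.lsingle (Nat.unpair j).2))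
      ⟨1, fun j x => by simp⟩)
    (clm_ext fun j x => by simp)
    (clm_ext fun k f => by
      -- The outer extensionality leaves an arbitrary inner sequence `f`; a second one reduces to
      -- single entries.
      have : (lsumL (fun j => (Finsupp.lsingle (Nat.unpair j).1 ∘ₗ
          Finsupp.lsingle (Nat.unpair j).2)) ⟨1, fun j x => by simp⟩ ∘L reindexL (Nat.pair k)) =
          (singleL k : (ℕ →₀ E) →L[ℝ] (ℕ →₀ ℕ →₀ E)) := clm_ext fun i x => by simp
      simpa using DFunLike.congr_fun this f)

@[simp] theorem pairL_single_single (k i : ℕ) (x : E) :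
    pairL (single k (single i x)) = single (Nat.pair k i) x := by
  simp [pairL]

end Finsupp

/-! ### The decomposition method -/

section Decomposition

variable {p : ℝ} {E F : Type*} [SeminormedAddCommGroup E] [Module ℝ E]
  [SeminormedAddCommGroup F] [Module ℝ F]

open Finsupp in
/-- If `E` is complemented in `F`, then `ℓ₁(F)` absorbs `E`. -/
noncomputable def absorbL (hp : 0 < p) (hF : IsPHomogeneous p F) (S : E →L[ℝ] F)
    (T : F →L[ℝ] E) (h : ∀ x, T (S x) = x) : (E × (ℕ →₀ F)) ≃L[ℝ] (ℕ →₀ F) :=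
  -- With the projection P = ST, `A` moves the P-part of every coordinate one place to the right and
  -- keeps the complementary part in place; `B` moves the P-parts back. The P-part of coordinate 0,
  -- vacated by `A`, receives `E`.
  let A : (ℕ →₀ F) →L[ℝ] (ℕ →₀ F) := (reindexL Nat.succ ∘L mapL hp hF hF (S ∘L T)) +
    mapL hp hF hF (ContinuousLinearMap.id ℝ F - S ∘L T)
  let B : (ℕ →₀ F) →L[ℝ] (ℕ →₀ F) := (mapL hp hF hF (S ∘L T) ∘L tailL) +
    mapL hp hF hF (ContinuousLinearMap.id ℝ F - S ∘L T)
  have hA : ∀ f, T (evalL 0 (A f)) = 0 := DFunLike.congr_fun (F := (ℕ →₀ F) →L[ℝ] E)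
    (f := T ∘L evalL 0 ∘L A) (g := 0) (clm_ext fun i x => by
      by_cases hi : i = 0 <;> simp [A, h, hi])
  have hBA : ∀ f, B (A f) = f := DFunLike.congr_fun (F := (ℕ →₀ F) →L[ℝ] (ℕ →₀ F))
    (f := B ∘L A) (g := .id ℝ _) (clm_ext fun i x => by rcases i with _ | i <;> simp [A, B, h])
  have hAB : ∀ f, single 0 (S (T (evalL 0 f))) + A (B f) = f :=
    DFunLike.congr_fun (F := (ℕ →₀ F) →L[ℝ] (ℕ →₀ F))
      (f := singleL 0 ∘L S ∘L T ∘L evalL 0 + A ∘L B) (g := .id ℝ _)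
      (clm_ext fun i x => by rcases i with _ | i <;> simp [A, B, h])
  have hB : ∀ e, B (single 0 (S e)) = 0 := fun e => by simp [B, h]
  ContinuousLinearEquiv.equivOfInverse
    ((singleL 0 ∘L S).coprod A) ((T ∘L evalL 0).prod B)
    (fun ⟨e, f⟩ => by
      refine Prod.ext ?_ ?_
      · simp [h, hA]
      · simp [hBA, hB])
    (fun f => by simpa using hAB f)

/-- A space in which `E` is complemented absorbs `E` if `E` is isomorphic to its square. -/
noncomputable def absorbOfSquareL (θ : (E × E) ≃L[ℝ] E) (S : E →L[ℝ] F) (T : F →L[ℝ] E)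
    (h : ∀ x, T (S x) = x) : (E × F) ≃L[ℝ] F :=
  ContinuousLinearEquiv.equivOfInverse
    -- Since F = S(E) ⊕ ker T, one has E × F ≅ (E × E) ⊕ ker T ≅ E ⊕ ker T ≅ F. The kernel component
    -- of `f` is `f - S (T f)`.
    (S ∘L θ.toContinuousLinearMap ∘L ((ContinuousLinearMap.fst ℝ E F).prod
        (T ∘L ContinuousLinearMap.snd ℝ E F)) +
      (ContinuousLinearMap.id ℝ F - S ∘L T) ∘L ContinuousLinearMap.snd ℝ E F)
    ((ContinuousLinearMap.fst ℝ E E ∘L θ.symm.toContinuousLinearMap ∘L T).prod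
      (S ∘L ContinuousLinearMap.snd ℝ E E ∘L θ.symm.toContinuousLinearMap ∘L T +
        (ContinuousLinearMap.id ℝ F - S ∘L T)))
    (by
      rintro ⟨e, f⟩
      simp [h])
    (by
      intro f
      simp [h])

/-- The decomposition method for `ℓ₁`-sums. -/
theorem nonempty_equiv_of_complemented (hp : 0 < p) (hE : IsPHomogeneous p E)
    (S : (ℕ →₀ E) →L[ℝ] F) (T : F →L[ℝ] (ℕ →₀ E)) (hTS : ∀ x, T (S x) = x)
    (S' : F →L[ℝ] (ℕ →₀ E)) (T' : (ℕ →₀ E) →L[ℝ] F) (hTS' : ∀ x, T' (S' x) = x) :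
    Nonempty (F ≃L[ℝ] (ℕ →₀ E)) := by
  have hX := Finsupp.isPHomogeneous (ι := ℕ) hE
  -- With X = ℓ(E) ≅ ℓ(X): X × X ≅ X × ℓ(X) ≅ ℓ(X) ≅ X.
  have θ : ((ℕ →₀ E) × (ℕ →₀ E)) ≃L[ℝ] (ℕ →₀ E) :=
    ((ContinuousLinearEquiv.refl ℝ _).prodCongr (Finsupp.pairL (E := E)).symm).trans
      ((absorbL hp hX (.id ℝ _) (.id ℝ _) fun _ => rfl).trans Finsupp.pairL)
  -- F ≅ X × F ≅ F × X ≅ F × ℓ(X) ≅ ℓ(X) ≅ X.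
  exact ⟨(absorbOfSquareL θ S T hTS).symm.trans <|
    (ContinuousLinearEquiv.prodComm ℝ (ℕ →₀ E) F).trans <|
    ((ContinuousLinearEquiv.refl ℝ F).prodCongr (Finsupp.pairL (E := E)).symm).trans <|
    (absorbL hp hX S' T' hTS').trans Finsupp.pairL⟩

end Decomposition

/-! ### Bounded linear maps on molecules -/

namespace Molecule

variable {p : ℝ} {M M' F : Type*} [MetricSpace M] [MetricSpace M']
  [SeminormedAddCommGroup F] [Module ℝ F]

theorem isPHomogeneous (hp : 0 < p) : IsPHomogeneous p (Molecule p M) :=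
  fun c m => norm_smul_eq hp c m

theorem norm_elem_le (x y : M) : ‖elem p x y‖ ≤ dist x y ^ p := by
  have := normPow_le (p := p) [((1 : ℝ), x, y)]
  simpa [norm_def] using this

omit [MetricSpace M] in
@[simp] theorem elem_self (x : M) : elem p x x = 0 :=
  toFinsupp_injective (by simp)

omit [MetricSpace M] in
theorem elem_sub_elem (x y o : M) : elem p x o - elem p y o = elem p x y :=
  toFinsupp_injective (by simp)

/-- The bounded linear map on molecules induced by a Lipschitz map. -/
noncomputable def liftL (hF : IsPHomogeneous p F) (g : M → F)
    (hg : ∃ K, ∀ x y, ‖g x - g y‖ ≤ K * dist x y ^ p) : Molecule p M →L[ℝ] F where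
  toLinearMap := LipschitzFree.lift₀ p g
  cont := by
    obtain ⟨K, hK⟩ := hg
    -- Subadditivity and p-homogeneity reduce the bound to elementary molecules. The maximum is
    -- there because `K` may be negative.
    have hl : ∀ l, ‖LipschitzFree.lift₀ p g (ofList p l)‖ ≤ max K 0 * cost p l := by
      intro l
      induction l with
      | nil => simp
      | cons t l ih =>
        rw [ofList_cons, map_add, map_smul, LipschitzFree.lift₀_elem, cost_cons, mul_add]
        refine (norm_add_le _ _).trans (add_le_add ?_ ih)
        rw [hF, Real.mul_rpow (abs_nonneg _) dist_nonneg, mul_left_comm]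
        refine mul_le_mul_of_nonneg_left ((hK _ _).trans ?_) (by positivity)
        exact mul_le_mul_of_nonneg_right (le_max_left _ _) (by positivity)
    refine AddMonoidHomClass.continuous_of_bound (LipschitzFree.lift₀ p g) (max K 0) fun m => ?_
    rcases (le_max_right K 0).eq_or_lt with h0 | h0
    · obtain ⟨l, rfl⟩ := exists_ofList m
      simpa [← h0] using hl l
    · rw [← div_le_iff₀' h0]
      refine le_normPow ?_
      rintro l rfl
      exact (div_le_iff₀' h0).2 (hl l)

@[simp] theorem liftL_elem (hF : IsPHomogeneous p F) (g : M → F) (hg) (x y : M) :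
    liftL hF g hg (elem p x y) = g x - g y :=
  LipschitzFree.lift₀_elem g x y

theorem clm_ext {f g : Molecule p M →L[ℝ] F} (h : ∀ x y, f (elem p x y) = g (elem p x y)) :
    f = g := by
  ext m
  obtain ⟨l, rfl⟩ := exists_ofList m
  induction l with
  | nil => simp
  | cons t l ih => simp [h, ih]

/-- The bounded linear map between molecules induced by a Lipschitz map of the metric spaces. -/
noncomputable def mapL (hp : 0 < p) (o : M) (f : M → M')
    (hf : ∃ K : NNReal, LipschitzWith K f) : Molecule p M →L[ℝ] Molecule p M' :=
  liftL (isPHomogeneous hp) (fun x => elem p (f x) (f o)) (by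
    obtain ⟨K, hK⟩ := hf
    refine ⟨K ^ p, fun x y => ?_⟩
    rw [elem_sub_elem, ← Real.mul_rpow K.coe_nonneg dist_nonneg]
    exact (norm_elem_le _ _).trans (Real.rpow_le_rpow dist_nonneg (hK.dist_le_mul x y) hp.le))

@[simp] theorem mapL_elem (hp : 0 < p) (o : M) (f : M → M') (hf) (x y : M) :
    mapL hp o f hf (elem p x y) = elem p (f x) (f y) := by
  simp [mapL, elem_sub_elem]

/-- The constant 1 does not depend on `f`, so that infinitely many such maps combine into one
bounded map on an ℓ₁-sum. -/
theorem norm_mapL_le (hp : 0 < p) (o : M) {f : M → M'} (hf : LipschitzWith 1 f)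
    (m : Molecule p M) : ‖mapL hp o f ⟨1, hf⟩ m‖ ≤ ‖m‖ := by
  refine le_normPow ?_
  rintro l rfl
  induction l with
  | nil => simp
  | cons t l ih =>
    rw [ofList_cons, map_add, map_smul, mapL_elem, cost_cons]
    refine (norm_add_le _ _).trans (add_le_add ?_ ih)
    rw [isPHomogeneous hp, Real.mul_rpow (abs_nonneg _) dist_nonneg]
    refine mul_le_mul_of_nonneg_left ((norm_elem_le _ _).trans ?_) (by positivity)
    exact Real.rpow_le_rpow dist_nonneg (by simpa using hf.dist_le_mul t.2.1 t.2.2) hp.le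

/-- A bi-Lipschitz bijection induces an isomorphism. -/
noncomputable def mapEquivL (hp : 0 < p) (o : M) (e : M ≃ M')
    (he : ∃ K : NNReal, LipschitzWith K e) (he' : ∃ K : NNReal, LipschitzWith K e.symm) :
    Molecule p M ≃L[ℝ] Molecule p M' :=
  ContinuousLinearEquiv.equivOfInverse' (mapL hp o e he) (mapL hp (e o) e.symm he')
    (clm_ext fun x y => by simp) (clm_ext fun x y => by simp)

end Molecule

namespace LipschitzFree

open UniformSpace

variable {p : ℝ} {M M' : Type*} [MetricSpace M] [MetricSpace M']

/-- The extension of a bounded linear map between molecules to the Lipschitz free spaces. -/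
theorem exists_extension (hp : 0 < p) (f : Molecule p M →L[ℝ] Molecule p M') :
    ∃ S : LipschitzFree p M →ₗ[ℝ] LipschitzFree p M', IsBoundedFor pnorm pnorm S ∧
      Continuous S ∧ ∀ m : Molecule p M, S m = (f m : Molecule p M') := by
  obtain ⟨C, hC0, hC⟩ := (Molecule.isPHomogeneous hp).exists_bound hp
    (Molecule.isPHomogeneous hp) f
  have hf := uniformContinuous_addMonoidHom_of_continuous f.continuous
  have hc : Continuous (Completion.map f) := Completion.continuous_map
  have hcoe : ∀ m : Molecule p M, Completion.map f m = (f m : Molecule p M') :=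
    Completion.map_coe hf
  let S : LipschitzFree p M →ₗ[ℝ] LipschitzFree p M' :=
    { toFun := Completion.map f
      map_add' := fun a b => by
        induction a, b using Completion.induction_on₂ with
        | hp => exact isClosed_eq (by fun_prop) (by fun_prop)
        | ih a b => rw [← Completion.coe_add, hcoe, hcoe, hcoe, map_add, Completion.coe_add]
      map_smul' := fun c a => by
        induction a using Completion.induction_on with
        | hp =>
          exact isClosed_eq (hc.comp (continuous_const_smul c)) ((continuous_const_smul c).comp hc)
        | ih a =>
          rw [← Completion.coe_smul, hcoe, hcoe, map_smul, RingHom.id_apply,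
            Completion.coe_smul] }
  have hS : ∀ z, ‖S z‖ ≤ C * ‖z‖ := fun z => by
    change ‖Completion.map f z‖ ≤ _
    induction z using Completion.induction_on with
    | hp => exact isClosed_le (by fun_prop) (by fun_prop)
    | ih m => rw [hcoe, Completion.norm_coe, Completion.norm_coe]; exact hC m
  -- The norm is the p-th power of `pnorm`, whence the root of the constant.
  refine ⟨S, ⟨C ^ (1 / p), fun z => ?_⟩, hc, hcoe⟩
  rw [pnorm, pnorm, ← Real.mul_rpow hC0 (norm_nonneg z)]
  exact Real.rpow_le_rpow (norm_nonneg _) (hS z) (by positivity)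

theorem quasiIsomorphic_of_equiv (hp : 0 < p) (e : Molecule p M ≃L[ℝ] Molecule p M') :
    QuasiIsomorphic (pnorm : LipschitzFree p M → ℝ) (pnorm : LipschitzFree p M' → ℝ) := by
  obtain ⟨S, hSb, hSc, hS⟩ := exists_extension hp e.toContinuousLinearMap
  obtain ⟨T, hTb, hTc, hT⟩ := exists_extension hp e.symm.toContinuousLinearMap
  refine ⟨S, T, hSb, hTb, LinearMap.ext fun z => ?_, LinearMap.ext fun z => ?_⟩
  · induction z using Completion.induction_on with
    | hp => exact isClosed_eq (hTc.comp hSc) continuous_id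
    | ih m => simp [hS, hT]
  · induction z using Completion.induction_on with
    | hp => exact isClosed_eq (hSc.comp hTc) continuous_id
    | ih m => simp [hS, hT]

end LipschitzFree

/-! ### Cutoff functions -/

theorem abs_min_sub_min_le_left {α : Type*} [AddCommGroup α] [LinearOrder α]
    [IsOrderedAddMonoid α] (a b c : α) : |min a b - min a c| ≤ |b - c| := by
  simpa using abs_min_sub_min_le_max a b a c

theorem abs_max_sub_max_le_left {α : Type*} [AddCommGroup α] [LinearOrder α]
    [IsOrderedAddMonoid α] (a b c : α) : |max a b - max a c| ≤ |b - c| := by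
  simpa using abs_max_sub_max_le_max a b a c

/-- The piecewise linear function that equals `1` up to `2 ^ n / 2` and `0` from `2 ^ n` on. -/
noncomputable def cutoff (n : ℕ) (t : ℝ) : ℝ := min 1 (max 0 (2 - 2 * t / 2 ^ n))

theorem cutoff_nonneg (n : ℕ) (t : ℝ) : 0 ≤ cutoff n t :=
  le_min zero_le_one (le_max_left _ _)

theorem cutoff_le_one (n : ℕ) (t : ℝ) : cutoff n t ≤ 1 := min_le_left _ _

theorem cutoff_eq_one {n : ℕ} {t : ℝ} (h : 2 * t ≤ 2 ^ n) : cutoff n t = 1 := by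
  refine min_eq_left (le_max_of_le_right ?_)
  have : 2 * t / 2 ^ n ≤ 1 := (div_le_one (by positivity)).2 h
  linarith

theorem cutoff_eq_zero {n : ℕ} {t : ℝ} (h : 2 ^ n ≤ t) : cutoff n t = 0 := by
  have : 2 ≤ 2 * t / 2 ^ n := (le_div_iff₀ (by positivity)).2 (by linarith)
  rw [cutoff, max_eq_left (by linarith), min_eq_right zero_le_one]

/-- The slope times the size 2^n of the cube is bounded independently of the scale; the uniform
Lipschitz bounds for the pieces rest on this. -/
theorem abs_cutoff_sub_le (n : ℕ) (s t : ℝ) :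
    |cutoff n s - cutoff n t| * 2 ^ n ≤ 2 * |s - t| := by
  have h : |cutoff n s - cutoff n t| ≤ |(2 - 2 * s / 2 ^ n) - (2 - 2 * t / 2 ^ n)| :=
    (abs_min_sub_min_le_left _ _ _).trans (abs_max_sub_max_le_left _ _ _)
  have h2 : (2 - 2 * s / 2 ^ n) - (2 - 2 * t / 2 ^ n) = -(2 * (s - t) / 2 ^ n) := by ring
  rw [h2, abs_neg, abs_div, abs_mul, abs_two, abs_of_pos (by positivity : (0 : ℝ) < 2 ^ n)] at h
  exact (le_div_iff₀ (by positivity)).1 h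

/-- The partition of unity on `[0, ∞)` formed by the differences of consecutive cutoffs. -/
noncomputable def bump : ℕ → ℝ → ℝ
  | 0, t => cutoff 0 t
  | n + 1, t => cutoff (n + 1) t - cutoff n t

theorem sum_bump (n : ℕ) (t : ℝ) : ∑ i ∈ Finset.range (n + 1), bump i t = cutoff n t := by
  induction n with
  | zero => simp [bump]
  | succ n ih => rw [Finset.sum_range_succ, ih, bump]; ring

theorem abs_bump_le_one (n : ℕ) (t : ℝ) : |bump n t| ≤ 1 := by
  cases n with
  | zero => rw [bump, abs_of_nonneg (cutoff_nonneg _ _)]; exact cutoff_le_one _ _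
  | succ n =>
    rw [bump, abs_le]
    have := cutoff_nonneg n t
    have := cutoff_nonneg (n + 1) t
    have := cutoff_le_one n t
    have := cutoff_le_one (n + 1) t
    constructor <;> linarith

theorem bump_eq_zero_of_le {n : ℕ} {t : ℝ} (h : 2 ^ n ≤ t) : bump n t = 0 := by
  cases n with
  | zero => exact cutoff_eq_zero h
  | succ n =>
    rw [bump, cutoff_eq_zero h, cutoff_eq_zero, sub_zero]
    exact (pow_le_pow_right₀ one_le_two n.le_succ).trans h

theorem bump_add_two_eq_zero {n : ℕ} {t : ℝ} (h : t ≤ 2 ^ n) : bump (n + 2) t = 0 := by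
  have : (0 : ℝ) < 2 ^ n := by positivity
  rw [bump, cutoff_eq_one, cutoff_eq_one, sub_self] <;> rw [pow_succ]
  · linarith
  · rw [pow_succ]; linarith

/-- At scale 2^(n+1) the outer cutoff contributes 2 and the inner one, which is twice as steep, 4.
-/
theorem abs_bump_sub_le (n : ℕ) (s t : ℝ) : |bump n s - bump n t| * 2 ^ n ≤ 6 * |s - t| := by
  cases n with
  | zero =>
    have := abs_cutoff_sub_le 0 s t
    have := abs_nonneg (s - t)
    simp only [bump]
    linarith
  | succ n =>
    have h1 := abs_cutoff_sub_le (n + 1) s t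
    have h2 := abs_cutoff_sub_le n s t
    have h : |bump (n + 1) s - bump (n + 1) t| ≤
        |cutoff (n + 1) s - cutoff (n + 1) t| + |cutoff n s - cutoff n t| := by
      have : bump (n + 1) s - bump (n + 1) t =
        (cutoff (n + 1) s - cutoff (n + 1) t) - (cutoff n s - cutoff n t) := by
          simp only [bump]; ring
      rw [this]
      exact abs_sub _ _
    have h3 := mul_le_mul_of_nonneg_right h (by positivity : (0 : ℝ) ≤ 2 ^ (n + 1))
    rw [add_mul] at h3
    have h4 : |cutoff n s - cutoff n t| * 2 ^ (n + 1) =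
      2 * (|cutoff n s - cutoff n t| * 2 ^ n) := by ring
    linarith

/-- For the least m with t < 2^m, the bumps before m vanish because t is too large, and those from m
+ 2 on because both of their cutoffs equal 1. -/
theorem exists_bump_support (t : ℝ) : ∃ s : Finset ℕ, s.card ≤ 2 ∧ ∀ n ∉ s, bump n t = 0 := by
  classical
  have hex : ∃ m : ℕ, t < 2 ^ m := pow_unbounded_of_one_lt t one_lt_two
  refine ⟨{Nat.find hex, Nat.find hex + 1}, Finset.card_le_two, fun n hn => ?_⟩
  simp only [Finset.mem_insert, Finset.mem_singleton, not_or] at hn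
  rcases lt_or_ge n (Nat.find hex) with h | h
  · exact bump_eq_zero_of_le (not_lt.1 (Nat.find_min hex h))
  · obtain ⟨k, rfl⟩ : ∃ k, n = k + 2 := ⟨n - 2, by omega⟩
    exact bump_add_two_eq_zero ((Nat.find_spec hex).le.trans
      (pow_le_pow_right₀ one_le_two (by omega)))

/-! ### Localized Lipschitz maps into molecules -/

/-- A Leibniz rule: the change of the weight is multiplied by the distance to the base point `b`,
the displacement of the point by the weight. The first product is controlled when the weight varies
slowly compared with the size of the region. -/
theorem Molecule.norm_smul_elem_sub_le {p : ℝ} (hp : 0 < p) {M M' : Type*} [MetricSpace M]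
    [MetricSpace M'] {φ : M → ℝ} {f : M → M'} {b : M'} {c : ℝ} {x y : M} (hc : 0 ≤ c)
    (h : |φ x - φ y| * dist (f x) b ≤ c * dist x y) (hy : |φ y| ≤ 1)
    (hf : dist (f x) (f y) ≤ dist x y) :
    ‖φ x • elem p (f x) b - φ y • elem p (f y) b‖ ≤ (c ^ p + 1) * dist x y ^ p := by
  have hsplit : φ x • elem p (f x) b - φ y • elem p (f y) b =
      (φ x - φ y) • elem p (f x) b + φ y • elem p (f x) (f y) := by
    rw [← elem_sub_elem (f x) (f y) b, sub_smul, smul_sub]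
    abel
  rw [hsplit, add_mul]
  refine (norm_add_le _ _).trans (add_le_add ?_ ?_)
  · rw [isPHomogeneous hp, ← Real.mul_rpow hc dist_nonneg]
    refine (mul_le_mul_of_nonneg_left (norm_elem_le _ _) (by positivity)).trans ?_
    rw [← Real.mul_rpow (abs_nonneg _) dist_nonneg]
    exact Real.rpow_le_rpow (by positivity) h hp.le
  · rw [isPHomogeneous hp]
    exact mul_le_mul (Real.rpow_le_one (abs_nonneg _) hy hp.le)
      ((norm_elem_le _ _).trans (Real.rpow_le_rpow dist_nonneg hf hp.le)) (norm_nonneg _)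
      zero_le_one

namespace Finsupp

variable {ι M E : Type*} [SeminormedAddCommGroup E]

/-- A pointwise finite family of functions, as a function with values in the `ℓ₁`-sum. -/
noncomputable def ofFamily (G : ι → M → E) {k : ℕ}
    (hG : ∀ x, ∃ s : Finset ι, s.card ≤ k ∧ ∀ i ∉ s, G i x = 0) (x : M) : ι →₀ E :=
  Finsupp.ofSupportFinite (fun i => G i x) <| by
    obtain ⟨s, -, hs⟩ := hG x
    exact s.finite_toSet.subset fun i hi => by
      by_contra h
      exact hi (hs i h)

@[simp] theorem ofFamily_apply (G : ι → M → E) {k : ℕ}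
    (hG : ∀ x, ∃ s : Finset ι, s.card ≤ k ∧ ∀ i ∉ s, G i x = 0) (x : M) (i : ι) :
    ofFamily G hG x i = G i x := rfl

/-- At most `k` coordinates are nonzero at each of the two points, so at most 2k coordinates
contribute. -/
theorem norm_ofFamily_sub_le (G : ι → M → E) {k : ℕ}
    (hG : ∀ x, ∃ s : Finset ι, s.card ≤ k ∧ ∀ i ∉ s, G i x = 0) {x y : M} {C : ℝ}
    (hC : 0 ≤ C) (h : ∀ i, ‖G i x - G i y‖ ≤ C) :
    ‖ofFamily G hG x - ofFamily G hG y‖ ≤ 2 * k * C := by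
  classical
  obtain ⟨s, hsc, hs⟩ := hG x
  obtain ⟨t, htc, ht⟩ := hG y
  rw [norm_def, sum_norm_eq_of_support_subset _ (s := s ∪ t)]
  · refine (Finset.sum_le_card_nsmul _ _ C fun i _ => by simpa using h i).trans ?_
    rw [nsmul_eq_mul]
    refine mul_le_mul_of_nonneg_right ?_ hC
    have : (s ∪ t).card ≤ 2 * k := (Finset.card_union_le _ _).trans (by omega)
    exact_mod_cast this
  · intro i hi
    simp only [Finset.mem_union, not_or] at hi
    simp [hs i hi.1, ht i hi.2]

end Finsupp

/-! ### The lattice `ℤ^d` -/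

namespace IntLattice

variable {d : ℕ}

/-- The coordinatewise retraction of `ℤ^d` onto the cube `[-2 ^ n, 2 ^ n]^d`. -/
def clamp (n : ℕ) (x : Fin d → ℤ) : Fin d → ℤ := fun i => max (-2 ^ n) (min (2 ^ n) (x i))

theorem norm_clamp_le (n : ℕ) (x : Fin d → ℤ) : ‖clamp n x‖ ≤ 2 ^ n := by
  refine (pi_norm_le_iff_of_nonneg (by positivity)).2 fun i => ?_
  have h : |clamp n x i| ≤ 2 ^ n := by
    have : (0 : ℤ) < 2 ^ n := by positivity
    rw [abs_le, clamp]
    exact ⟨le_max_left _ _, max_le (by linarith) (min_le_left _ _)⟩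
  rw [Int.norm_eq_abs]
  exact_mod_cast h

theorem clamp_eq_self {n : ℕ} {x : Fin d → ℤ} (h : ‖x‖ ≤ 2 ^ n) : clamp n x = x := by
  funext i
  have h1 : |x i| ≤ 2 ^ n := by
    have := (norm_le_pi_norm x i).trans h
    rw [Int.norm_eq_abs] at this
    exact_mod_cast this
  rw [abs_le] at h1
  rw [clamp, min_eq_right h1.2, max_eq_right h1.1]

theorem dist_clamp_le (n : ℕ) (x y : Fin d → ℤ) : dist (clamp n x) (clamp n y) ≤ dist x y := by
  refine (dist_pi_le_iff dist_nonneg).2 fun i => le_trans ?_ (dist_le_pi_dist x y i)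
  rw [Int.dist_eq, Int.dist_eq]
  have h : |clamp n x i - clamp n y i| ≤ |x i - y i| :=
    (abs_max_sub_max_le_left _ _ _).trans (abs_min_sub_min_le_left _ _ _)
  exact_mod_cast h

/-- The coordinatewise retraction of `ℤ^d` onto the positive lattice points. -/
def toPos (x : Fin d → ℤ) : Fin d → ℕ+ := fun i => ⟨(max 1 (x i)).toNat, by omega⟩

/-- The inclusion of the positive lattice points. -/
def ofPos (x : Fin d → ℕ+) : Fin d → ℤ := fun i => (x i : ℕ)

theorem ofPos_toPos {x : Fin d → ℤ} (h : ∀ i, 1 ≤ x i) : ofPos (toPos x) = x := by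
  funext i
  have := h i
  simp only [ofPos, toPos, PNat.mk_coe]
  omega

@[simp] theorem toPos_ofPos (x : Fin d → ℕ+) : toPos (ofPos x) = x := by
  funext i
  have := (x i).pos
  apply PNat.coe_injective
  simp only [ofPos, toPos, PNat.mk_coe]
  omega

theorem lipschitzWith_toPos : LipschitzWith 1 (toPos : (Fin d → ℤ) → Fin d → ℕ+) := by
  refine LipschitzWith.of_dist_le_mul fun x y => ?_
  rw [NNReal.coe_one, one_mul]
  refine (dist_pi_le_iff dist_nonneg).2 fun i => le_trans ?_ (dist_le_pi_dist x y i)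
  have h : |((toPos x i : ℕ) : ℤ) - (toPos y i : ℕ)| ≤ |x i - y i| := by
    have hx : ((toPos x i : ℕ) : ℤ) = max 1 (x i) := by simp only [toPos, PNat.mk_coe]; omega
    have hy : ((toPos y i : ℕ) : ℤ) = max 1 (y i) := by simp only [toPos, PNat.mk_coe]; omega
    rw [hx, hy]
    exact abs_max_sub_max_le_left _ _ _
  rw [PNat.dist_eq, Int.dist_eq]
  exact_mod_cast h

theorem lipschitzWith_ofPos : LipschitzWith 1 (ofPos : (Fin d → ℕ+) → Fin d → ℤ) := by
  refine LipschitzWith.of_dist_le_mul fun x y => ?_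
  rw [NNReal.coe_one, one_mul]
  refine (dist_pi_le_iff dist_nonneg).2 fun i => le_trans ?_ (dist_le_pi_dist x y i)
  rw [PNat.dist_eq, Int.dist_eq]
  simp [ofPos]

/-- The centres of the cubes that are placed among the positive lattice points. -/
def centre (d j : ℕ) : Fin d → ℤ := fun _ => 24 * 2 ^ j

theorem coord_bounds {j : ℕ} {y : Fin d → ℤ} (h : ‖y - centre d j‖ ≤ 2 ^ (j + 1)) (i : Fin d) :
    22 * 2 ^ j ≤ y i ∧ y i ≤ 26 * 2 ^ j := by
  have h1 : |y i - 24 * 2 ^ j| ≤ 2 ^ (j + 1) := by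
    have := (norm_le_pi_norm _ i).trans h
    rw [Int.norm_eq_abs] at this
    exact_mod_cast this
  rw [abs_le, pow_succ] at h1
  constructor <;> linarith

/-- The coordinates lie in [22·2^j, 26·2^j], strictly inside the dyadic interval from 2^(j+4) to
2^(j+5). Hence the enlarged cubes are disjoint, and any single coordinate determines `j`. -/
theorem eq_log_of_norm_le (hd : 0 < d) {j : ℕ} {y : Fin d → ℤ}
    (h : ‖y - centre d j‖ ≤ 2 ^ (j + 1)) : j = Nat.log 2 (y ⟨0, hd⟩).toNat - 4 := by
  obtain ⟨h1, h2⟩ := coord_bounds h ⟨0, hd⟩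
  have hpos : (0 : ℤ) < 2 ^ j := by positivity
  have : Nat.log 2 (y ⟨0, hd⟩).toNat = j + 4 := by
    refine Nat.log_eq_of_pow_le_of_lt_pow ?_ ?_
    · zify
      rw [Int.toNat_of_nonneg (by linarith), pow_add]
      linarith
    · zify
      rw [Int.toNat_of_nonneg (by linarith), pow_add, pow_add]
      linarith
  omega

end IntLattice

/-! ### Free spaces over `ℤ^d` and its positive part -/

namespace IntLattice

open Molecule

variable {p : ℝ} {d : ℕ}

-- Dyadic decomposition of molecules on ℤ^d

/-- The piece of `x` in the `n`-th cube of the dyadic decomposition of `ℤ^d`. -/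
noncomputable def piece (p : ℝ) (n : ℕ) (x : Fin d → ℤ) : Molecule p (Fin d → ℤ) :=
  bump n ‖x‖ • elem p (clamp n x) 0

theorem exists_piece_support (x : Fin d → ℤ) :
    ∃ s : Finset ℕ, s.card ≤ 2 ∧ ∀ n ∉ s, piece p n x = 0 := by
  obtain ⟨s, hs, h⟩ := exists_bump_support ‖x‖
  exact ⟨s, hs, fun n hn => by rw [piece, h n hn, zero_smul]⟩

/-- Clamping keeps the distance to the base point at most 2^n, even where the bump vanishes, so the
Leibniz estimate applies to every pair of points with a constant independent of `n`. -/
theorem norm_piece_sub_le (hp : 0 < p) (n : ℕ) (x y : Fin d → ℤ) :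
    ‖piece p n x - piece p n y‖ ≤ (6 ^ p + 1) * dist x y ^ p := by
  refine norm_smul_elem_sub_le (φ := fun x => bump n ‖x‖) (f := clamp n) hp (by norm_num) ?_
    (abs_bump_le_one _ _) (dist_clamp_le n x y)
  rw [dist_zero_right]
  refine (mul_le_mul_of_nonneg_left (norm_clamp_le n x) (abs_nonneg _)).trans
    ((abs_bump_sub_le n _ _).trans ?_)
  rw [dist_eq_norm]
  exact mul_le_mul_of_nonneg_left (abs_norm_sub_norm_le x y) (by norm_num)

/-- The weight vanishes wherever clamping could move the point. -/
theorem piece_eq (n : ℕ) (x : Fin d → ℤ) : piece p n x = bump n ‖x‖ • elem p x 0 := by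
  rcases le_total ‖x‖ (2 ^ n) with h | h
  · rw [piece, clamp_eq_self h]
  · rw [piece, bump_eq_zero_of_le h, zero_smul, zero_smul]

/-- The decomposition of molecules on `ℤ^d` along the dyadic cubes. -/
noncomputable def spreadL (hp : 0 < p) :
    Molecule p (Fin d → ℤ) →L[ℝ] (ℕ →₀ Molecule p (Fin d → ℤ)) :=
  liftL (Finsupp.isPHomogeneous (isPHomogeneous hp))
    (Finsupp.ofFamily (piece p) exists_piece_support) <| by
    refine ⟨2 * (2 : ℕ) * (6 ^ p + 1), fun x y => ?_⟩
    rw [mul_assoc]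
    exact Finsupp.norm_ofFamily_sub_le _ _ (by positivity) fun n => norm_piece_sub_le hp n x y

/-- The sum of the components. -/
noncomputable def sumL : (ℕ →₀ Molecule p (Fin d → ℤ)) →L[ℝ] Molecule p (Fin d → ℤ) :=
  Finsupp.lsumL (fun _ => LinearMap.id) ⟨1, by simp⟩

@[simp] theorem sumL_single (n : ℕ) (m : Molecule p (Fin d → ℤ)) :
    sumL (Finsupp.single n m) = m := by
  simp [sumL]

theorem sumL_ofFamily_piece (x : Fin d → ℤ) :
    sumL (Finsupp.ofFamily (piece p) exists_piece_support x) = elem p x 0 := by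
  set f := Finsupp.ofFamily (piece p) exists_piece_support x
  -- `N` makes the telescoped cutoff equal to 1 at ‖x‖; `N'` makes the range contain the support.
  obtain ⟨N, hN⟩ := pow_unbounded_of_one_lt (2 * ‖x‖) one_lt_two
  obtain ⟨N', hN'⟩ := f.support.bddAbove
  have hf : f = ∑ n ∈ Finset.range (max N N' + 1), Finsupp.single n (piece p n x) := by
    conv_lhs => rw [← Finsupp.sum_single f]
    exact Finsupp.sum_of_support_subset _ (fun n hn => by
      have := hN' hn
      simp only [Finset.mem_range]
      omega) _ (by simp)
  rw [hf, map_sum]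
  simp only [sumL_single, piece_eq]
  rw [← Finset.sum_smul, sum_bump, cutoff_eq_one, one_smul]
  exact hN.le.trans (pow_le_pow_right₀ one_le_two (le_max_left _ _))

theorem sumL_spreadL (hp : 0 < p) (m : Molecule p (Fin d → ℤ)) : sumL (spreadL hp m) = m := by
  refine DFunLike.congr_fun (f := sumL ∘L spreadL hp) (g := .id ℝ _) (clm_ext fun x y => ?_) m
  simp [spreadL, sumL_ofFamily_piece, elem_sub_elem]

-- Separated cubes among the positive lattice points

/-- The half side length exponent of the `j`-th cube among the positive lattice points: every
exponent occurs infinitely often. -/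
def cubeExp (j : ℕ) : ℕ := (Nat.unpair j).2

theorem cubeExp_le (j : ℕ) : cubeExp j ≤ j := Nat.unpair_right_le j

/-- The piece of `y` in the `j`-th cube among the positive lattice points. -/
noncomputable def cubePiece (p : ℝ) (j : ℕ) (y : Fin d → ℤ) : Molecule p (Fin d → ℤ) :=
  cutoff (cubeExp j + 1) ‖y - centre d j‖ • elem p (clamp (cubeExp j) (y - centre d j)) 0

theorem cubePiece_eq_zero (hd : 0 < d) {j : ℕ} {y : Fin d → ℤ}
    (h : j ≠ Nat.log 2 (y ⟨0, hd⟩).toNat - 4) : cubePiece p j y = 0 := by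
  rw [cubePiece, cutoff_eq_zero, zero_smul]
  by_contra! hlt
  exact h (eq_log_of_norm_le hd (hlt.le.trans
    (pow_le_pow_right₀ one_le_two (Nat.succ_le_succ (cubeExp_le j)))))

theorem exists_cubePiece_support (hd : 0 < d) (y : Fin d → ℤ) :
    ∃ s : Finset ℕ, s.card ≤ 1 ∧ ∀ j ∉ s, cubePiece p j y = 0 :=
  ⟨{Nat.log 2 (y ⟨0, hd⟩).toNat - 4}, by simp, fun _ hj =>
    cubePiece_eq_zero hd (by simpa using hj)⟩

/-- The cutoff is one scale above the clamp: it equals 1 on the cube and dies out by twice its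
radius, while the clamp keeps the point in the cube. The bound is uniform in `j`. -/
theorem norm_cubePiece_sub_le (hp : 0 < p) (j : ℕ) (x y : Fin d → ℤ) :
    ‖cubePiece p j x - cubePiece p j y‖ ≤ (2 ^ p + 1) * dist x y ^ p := by
  refine norm_smul_elem_sub_le (φ := fun y => cutoff (cubeExp j + 1) ‖y - centre d j‖)
    (f := fun y => clamp (cubeExp j) (y - centre d j)) hp (by norm_num) ?_ ?_ ?_
  · rw [dist_zero_right]
    refine (mul_le_mul_of_nonneg_left ((norm_clamp_le _ _).trans
      (pow_le_pow_right₀ one_le_two (Nat.le_succ _))) (abs_nonneg _)).trans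
      ((abs_cutoff_sub_le _ _ _).trans ?_)
    rw [← dist_sub_right x y (centre d j), dist_eq_norm]
    exact mul_le_mul_of_nonneg_left (abs_norm_sub_norm_le _ _) (by norm_num)
  · rw [abs_of_nonneg (cutoff_nonneg _ _)]
    exact cutoff_le_one _ _
  · exact (dist_clamp_le _ _ _).trans (dist_sub_right _ _ _).le

/-- The restriction of molecules on the positive lattice points to the disjoint cubes. -/
noncomputable def retrieveL (hp : 0 < p) (hd : 0 < d) :
    Molecule p (Fin d → ℕ+) →L[ℝ] (ℕ →₀ Molecule p (Fin d → ℤ)) :=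
  liftL (Finsupp.isPHomogeneous (isPHomogeneous hp))
    (fun y => Finsupp.ofFamily (cubePiece p) (exists_cubePiece_support hd) (ofPos y)) <| by
    refine ⟨2 * (1 : ℕ) * (2 ^ p + 1), fun x y => ?_⟩
    rw [mul_assoc]
    refine Finsupp.norm_ofFamily_sub_le _ _ (by positivity) fun j =>
      (norm_cubePiece_sub_le hp j _ _).trans ?_
    gcongr
    simpa using lipschitzWith_ofPos.dist_le_mul x y

theorem lipschitzWith_toPos_add (v : Fin d → ℤ) :
    LipschitzWith 1 fun x : Fin d → ℤ => toPos (x + v) := by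
  refine LipschitzWith.of_dist_le_mul fun x y => ?_
  simpa using lipschitzWith_toPos.dist_le_mul (x + v) (y + v)

/-- The placement of molecules on the cubes among the positive lattice points. -/
noncomputable def placeL (hp : 0 < p) :
    (ℕ →₀ Molecule p (Fin d → ℤ)) →L[ℝ] Molecule p (Fin d → ℕ+) :=
  Finsupp.lsumL (fun j => (mapL hp 0 (fun x => toPos (x + centre d j))
    ⟨1, lipschitzWith_toPos_add _⟩).toLinearMap)
    ⟨1, fun j m => by simpa using norm_mapL_le hp 0 (lipschitzWith_toPos_add (centre d j)) m⟩

theorem ofFamily_cubePiece (hd : 0 < d) {j : ℕ} {a : Fin d → ℤ} (ha : ‖a‖ ≤ 2 ^ cubeExp j) :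
    Finsupp.ofFamily (cubePiece p) (exists_cubePiece_support hd) (ofPos (toPos (a + centre d j))) =
      Finsupp.single j (elem p a 0) := by
  have hnorm : ‖a + centre d j - centre d j‖ ≤ 2 ^ (j + 1) := by
    rw [add_sub_cancel_right]
    exact ha.trans (pow_le_pow_right₀ one_le_two ((cubeExp_le j).trans j.le_succ))
  rw [ofPos_toPos fun i => by
    have := (coord_bounds hnorm i).1
    have : (0 : ℤ) < 2 ^ j := by positivity
    linarith]
  ext1 i
  rw [Finsupp.ofFamily_apply]
  rcases eq_or_ne j i with rfl | hij
  · rw [Finsupp.single_eq_same, cubePiece, add_sub_cancel_right, cutoff_eq_one, one_smul,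
      clamp_eq_self ha]
    rw [pow_succ]
    linarith
  · rw [Finsupp.single_eq_of_ne hij.symm]
    exact cubePiece_eq_zero hd (eq_log_of_norm_le hd hnorm ▸ hij.symm)

theorem retrieveL_placeL_single (hp : 0 < p) (hd : 0 < d) {j : ℕ} {a : Fin d → ℤ}
    (ha : ‖a‖ ≤ 2 ^ cubeExp j) :
    retrieveL hp hd (placeL hp (Finsupp.single j (elem p a 0))) =
      Finsupp.single j (elem p a 0) := by
  -- The base point 0 is placed at the centre of the cube, where the family takes the value 0, so it
  -- contributes no error term.
  have h0 := ofFamily_cubePiece (p := p) hd (j := j) (a := 0) (by simp)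
  rw [zero_add, elem_self, Finsupp.single_zero] at h0
  simp [placeL, retrieveL, ofFamily_cubePiece hd ha, h0]

/-- Retrieval undoes placement only for molecules inside the prescribed cubes. This is enough after
spreading, since the n-th piece lives in the cube of exponent n. -/
theorem retrieveL_placeL_pairL_spreadL (hp : 0 < p) (hd : 0 < d) (k : ℕ)
    (m : Molecule p (Fin d → ℤ)) :
    retrieveL hp hd (placeL hp (Finsupp.pairL (Finsupp.single k (spreadL hp m)))) =
      Finsupp.pairL (Finsupp.single k (spreadL hp m)) := by
  have key : ∀ x : Fin d → ℤ,
      retrieveL hp hd (placeL hp (Finsupp.pairL (Finsupp.single k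
        (Finsupp.ofFamily (piece p) exists_piece_support x)))) =
      Finsupp.pairL (Finsupp.single k (Finsupp.ofFamily (piece p) exists_piece_support x)) := by
    intro x
    set f := Finsupp.ofFamily (piece p) exists_piece_support x
    have hf : f = ∑ n ∈ f.support, Finsupp.single n (piece p n x) := by
      conv_lhs => rw [← Finsupp.sum_single f]
      rfl
    rw [hf, ← Finsupp.singleL_apply]
    simp only [map_sum, Finsupp.singleL_apply, Finsupp.pairL_single_single]
    refine Finset.sum_congr rfl fun n _ => ?_
    rw [piece, ← Finsupp.smul_single]
    simp only [map_smul]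
    rw [retrieveL_placeL_single]
    -- The pairing puts the n-th piece of the k-th copy at index `Nat.pair k n`, whose cube has
    -- exponent exactly n.
    simpa [cubeExp] using norm_clamp_le n x
  refine DFunLike.congr_fun
    (f := retrieveL hp hd ∘L placeL hp ∘L Finsupp.pairL.toContinuousLinearMap ∘L
      Finsupp.singleL k ∘L spreadL hp)
    (g := Finsupp.pairL.toContinuousLinearMap ∘L Finsupp.singleL k ∘L spreadL hp)
    (clm_ext fun x y => ?_) m
  simp [spreadL, Finsupp.single_sub, key]

theorem nonempty_equiv (hp : 0 < p) (hd : 0 < d) :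
    Nonempty (Molecule p (Fin d → ℕ+) ≃L[ℝ] Molecule p (Fin d → ℤ)) := by
  have hP : IsPHomogeneous p (Molecule p (Fin d → ℤ)) := isPHomogeneous hp
  have hX := Finsupp.isPHomogeneous (ι := ℕ) hP
  let S : (ℕ →₀ Molecule p (Fin d → ℤ)) →L[ℝ] Molecule p (Fin d → ℕ+) :=
    placeL hp ∘L Finsupp.pairL.toContinuousLinearMap ∘L Finsupp.mapL hp hP hX (spreadL hp)
  let T : Molecule p (Fin d → ℕ+) →L[ℝ] (ℕ →₀ Molecule p (Fin d → ℤ)) :=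
    Finsupp.mapL hp hX hP sumL ∘L (Finsupp.pairL (E := Molecule p (Fin d → ℤ))).symm.toContinuousLinearMap ∘L
      retrieveL hp hd
  have hTS : ∀ x, T (S x) = x := DFunLike.congr_fun (f := T ∘L S) (g := .id ℝ _)
    (Finsupp.clm_ext fun k m => by
      simp [S, T, retrieveL_placeL_pairL_spreadL, sumL_spreadL])
  let R : Molecule p (Fin d → ℤ) →L[ℝ] Molecule p (Fin d → ℕ+) :=
    mapL hp 0 toPos ⟨1, lipschitzWith_toPos⟩
  let I : Molecule p (Fin d → ℕ+) →L[ℝ] Molecule p (Fin d → ℤ) :=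
    mapL hp 1 ofPos ⟨1, lipschitzWith_ofPos⟩
  have hRI : ∀ x, R (I x) = x := DFunLike.congr_fun (f := R ∘L I) (g := .id ℝ _)
    (clm_ext fun x y => by simp [R, I])
  -- `S` and `T` complement ℓ(X) in Y. Composition with the retraction pair `I`, `R` gives the
  -- complementations still needed: Y in ℓ(X) through the summand 0, and ℓ(X) in X through Y.
  obtain ⟨e⟩ := nonempty_equiv_of_complemented hp hP S T hTS (Finsupp.singleL 0 ∘L I)
    (R ∘L Finsupp.evalL 0) (fun x => by simp [hRI])
  obtain ⟨e'⟩ := nonempty_equiv_of_complemented hp hP (I ∘L S) (T ∘L R)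
    (fun x => by simp [hRI, hTS]) (Finsupp.singleL 0) (Finsupp.evalL 0) (fun x => by simp)
  exact ⟨e.trans e'.symm⟩

end IntLattice

-- Dimension zero and the change to the ℓ_q metric

theorem Molecule.subsingleton (p : ℝ) (M : Type*) [Subsingleton M] :
    Subsingleton (Molecule p M) := by
  refine subsingleton_of_forall_eq 0 fun m => ?_
  obtain ⟨l, rfl⟩ := exists_ofList m
  induction l with
  | nil => rfl
  | cons t l ih =>
    rw [ofList_cons, ih, Subsingleton.elim t.2.1 t.2.2, elem_self, smul_zero, zero_add]

/-- The free spaces over a finite `ℓ_q`-product and over the `ℓ_∞`-product are isomorphic. -/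
noncomputable def Molecule.piLpEquivL {p : ℝ} (hp : 0 < p) (q : ℝ≥0∞) [Fact (1 ≤ q)]
    {ι : Type*} [Fintype ι] (A : Type*) [MetricSpace A] (o : A) :
    Molecule p (PiLp q fun _ : ι => A) ≃L[ℝ] Molecule p (ι → A) :=
  mapEquivL hp (WithLp.toLp q fun _ => o) (WithLp.equiv q (ι → A))
    ⟨_, PiLp.lipschitzWith_ofLp q fun _ : ι => A⟩ ⟨_, PiLp.lipschitzWith_toLp q fun _ : ι => A⟩

/-- `ℕ+` and `ℤ` carry the usual distance, and `PiLp q` the `ℓ_q`-product distance. -/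
theorem theorem5 (p : ℝ) (hp0 : 0 < p) (hp1 : p ≤ 1) (d : ℕ) (q : ℝ≥0∞) [Fact (1 ≤ q)] :
    QuasiIsomorphic
      (LipschitzFree.pnorm : LipschitzFree p (PiLp q fun _ : Fin d => ℕ+) → ℝ)
      (LipschitzFree.pnorm : LipschitzFree p (PiLp q fun _ : Fin d => ℤ) → ℝ) := by
  obtain ⟨e⟩ : Nonempty (Molecule p (Fin d → ℕ+) ≃L[ℝ] Molecule p (Fin d → ℤ)) := by
    -- Locating the cubes requires a coordinate; for d = 0 both lattices are single points and both
    -- spaces are trivial.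
    rcases d.eq_zero_or_pos with rfl | hd
    · have := Molecule.subsingleton p (Fin 0 → ℕ+)
      have := Molecule.subsingleton p (Fin 0 → ℤ)
      exact ⟨ContinuousLinearEquiv.equivOfInverse 0 0 (fun _ => Subsingleton.elim _ _)
        fun _ => Subsingleton.elim _ _⟩
    · exact IntLattice.nonempty_equiv hp0 hd
  exact LipschitzFree.quasiIsomorphic_of_equiv hp0 <|
    (Molecule.piLpEquivL hp0 q ℕ+ 1).trans <| e.trans (Molecule.piLpEquivL hp0 q ℤ 0).symm
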